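/- Let $n,m\in\mathbb{N}$ and consider the control-affine system $$x_{k+1}=f(x_k)+g(x_k)u_k+w_k,\qquad k=0,1,2,\dots,$$ with state $x_k\in\mathbb{R}^n$, control $u_k\in\mathbb{R}^m$, arbitrary functions $f:\mathbb{R}^n\to\mathbb{R}^n$ and $g:\mathbb{R}^n\to\mathbb{R}^{n\times m}$, and independent Gaussian noise vectors $w_k\sim\mathcal{N}(\mu_w,\Sigma_w)$, where $\mu_w\in\mathbb{R}^n$ is arbitrary (possibly non-zero) and $\Sigma_w\succeq 0$. Assume that $\Sigma_w\preceq\sigma I$ for a real number $\sigma>0$. Let $\delta>0$ and let $t\ge 2$ be an integer. Put $$\widehat\mu_w=\frac1t\sum_{k=0}^{t-1}w_k,\qquad \widehat\Sigma_w=\frac1{t-1}\sum_{k=0}^{t-1}(w_k-\widehat\mu_w)(w_k-\widehat\mu_w)^\top,$$ and let $\Omega\subseteq\mathbb{R}^n$ be the (random) set of all $w$ for which there is $a\in\mathbb{R}^n$ with $a^\top a\le \frac{3n\sigma}{t\delta}$ and $$(w-\widehat\mu_w-a)^\top\left(\widehat\Sigma_w+\sigma\sqrt{\frac{3n(n+1)}{\delta(t-1)}}\,I\right)^{-1}(w-\widehat\mu_w-a)\le\frac{3n}{\delta}.$$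 Let $H_{t+1}$ be a real matrix with $n$ columns and $h_{t+1}$ a real vector with as many entries as $H_{t+1}$ has rows; a state $x_{t+1}$ is called safe if $H_{t+1}x_{t+1}\le h_{t+1}$ element-wise. Given a (random) nominal control $\bar u_t\in\mathbb{R}^m$ and a real-valued function $\mathbf d$ on $\mathbb{R}^m\times\mathbb{R}^m$ (for example a distance), consider the robust program $$\min_{u\in\mathbb{R}^m}\ \mathbf d(u,\bar u_t)\quad\text{subject to}\quad H_{t+1}\bigl(f(x_t)+g(x_t)u+w\bigr)\le h_{t+1}\ \text{ for all } w\in\Omega ,$$ and suppose that, almost surely, $u_t$ is a minimizer of this program whenever the program is feasible. Then $$\mathbb{P}\{\text{the program is feasible and } x_{t+1}\text{ is not safe}\}\le\delta .$$ In particular, if the program is almost surely feasible, then $$\mathbb{P}\{H_{t+1}x_{t+1}\le h_{t+1}\}\ge 1-\delta .$$ -/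

import Mathlib

open MeasureTheory ProbabilityTheory Matrix

noncomputable section

namespace SafeLearning

/-- Column vectors with the Euclidean norm. -/
abbrev Vec (n : ℕ) := EuclideanSpace ℝ (Fin n)

variable {n m p : ℕ}

/-- One step of the control-affine system: `f(x) + g(x) u + w`. -/
def step (f : Vec n → Vec n) (g : Vec n → Matrix (Fin n) (Fin m) ℝ)
    (x : Vec n) (u : Vec m) (w : Vec n) : Vec n :=
  f x + WithLp.toLp 2 (g x *ᵥ u.ofLp) + w

/-- The safety constraint `H x ≤ h`, element-wise. -/
def IsSafe (H : Matrix (Fin p) (Fin n) ℝ) (h : Fin p → ℝ) (x : Vec n) : Prop :=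
  ∀ i, (H *ᵥ x.ofLp) i ≤ h i

/-- Empirical mean of `w 0, …, w (t-1)`. -/
def empMean (w : ℕ → Vec n) (t : ℕ) : Vec n :=
  (1 / (t : ℝ)) • ∑ k ∈ Finset.range t, w k

/-- Empirical covariance of `w 0, …, w (t-1)`, with the normalization `1 / (t - 1)`. -/
def empCov (w : ℕ → Vec n) (t : ℕ) : Matrix (Fin n) (Fin n) ℝ :=
  (1 / ((t : ℝ) - 1)) • ∑ k ∈ Finset.range t,
    vecMulVec (w k - empMean w t).ofLp (w k - empMean w t).ofLp

/-- The inflated empirical covariance. -/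
def inflatedCov (σ δ : ℝ) (w : ℕ → Vec n) (t : ℕ) : Matrix (Fin n) (Fin n) ℝ :=
  empCov w t +
    (σ * Real.sqrt (3 * (n : ℝ) * ((n : ℝ) + 1) / (δ * ((t : ℝ) - 1)))) •
      (1 : Matrix (Fin n) (Fin n) ℝ)

/-- The uncertainty set: all `v` such that, for some `a` in the ball `aᵀ a ≤ 3nσ / (tδ)`, the point
`v - a` lies in the ellipsoid of the inflated covariance centred at the empirical mean. -/
def uncertaintySet (σ δ : ℝ) (w : ℕ → Vec n) (t : ℕ) : Set (Vec n) :=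
  {v | ∃ a : Vec n,
    a.ofLp ⬝ᵥ a.ofLp ≤ 3 * (n : ℝ) * σ / ((t : ℝ) * δ) ∧
    (v - empMean w t - a).ofLp ⬝ᵥ
      ((inflatedCov σ δ w t)⁻¹ *ᵥ (v - empMean w t - a).ofLp) ≤ 3 * (n : ℝ) / δ}

/-- The feasible set of the robust program at the state `x`: the controls that make the next state
safe for every disturbance in `W`. -/
def feasibleControls (f : Vec n → Vec n) (g : Vec n → Matrix (Fin n) (Fin m) ℝ)
    (H : Matrix (Fin p) (Fin n) ℝ) (h : Fin p → ℝ) (W : Set (Vec n)) (x : Vec n) :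
    Set (Vec m) :=
  {u | ∀ w ∈ W, IsSafe H h (step f g x u w)}

/-- The minimizers of `d(·, ubar)` over the set `S` of controls. -/
def argminControls (d : Vec m → Vec m → ℝ) (ubar : Vec m) (S : Set (Vec m)) : Set (Vec m) :=
  {u | u ∈ S ∧ ∀ v ∈ S, d u ubar ≤ d v ubar}

end SafeLearning

end

namespace SafeLearning

/-! A feasible control makes the next state safe for every disturbance in the uncertainty set, so it
suffices that `w t` misses this set with probability at most `δ`. Three events of probability at
most `δ / 3` each are excluded: the empirical mean is far from `μ`, the empirical covariance is far
from `S` in Frobenius norm, or `w t` leaves the image of a ball under `ξ ↦ μ + √S ξ`. Outside them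
`mem_uncertaintySet` is pure linear algebra: the shift `a` absorbs the error of the mean, and the
inflation absorbs that of the covariance. Each event is bounded by Markov's inequality. Only the
covariance needs more than second moments: its mean squared error (`integral_empCov_sub_sq`) rests
on Isserlis' formula, obtained by polarization from the fourth moment of a real Gaussian. -/

lemma iteratedDeriv_four_exp_mul_sq (v : ℝ) :
    iteratedDeriv 4 (fun s : ℝ => Real.exp (v * s ^ 2 / 2)) 0 = 3 * v ^ 2 := by
  have h0 : ∀ s : ℝ, HasDerivAt (fun s : ℝ => Real.exp (v * s ^ 2 / 2))
      (Real.exp (v * s ^ 2 / 2) * (v * s)) s := fun s => by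
    have : HasDerivAt (fun s : ℝ => v * s ^ 2 / 2) (v * s) s := by
      convert! ((hasDerivAt_pow 2 s).const_mul v).div_const 2 using 1
      simp; ring
    exact this.exp
  -- Products of the exponential with a function `q` stay of this form under differentiation, `q`
  -- becoming `v s q + q'`.
  have key : ∀ q q' : ℝ → ℝ, (∀ s, HasDerivAt q (q' s) s) →
      deriv (fun s => Real.exp (v * s ^ 2 / 2) * q s) =
        fun s => Real.exp (v * s ^ 2 / 2) * (v * s * q s + q' s) := by
    intro q q' hq
    funext s
    rw [((h0 s).fun_mul (hq s)).deriv]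
    ring
  have h1 : deriv (fun s : ℝ => Real.exp (v * s ^ 2 / 2)) =
      fun s => Real.exp (v * s ^ 2 / 2) * (v * s) := funext fun s => (h0 s).deriv
  have hid : ∀ s : ℝ, HasDerivAt (fun s : ℝ => v * s) v s := fun s => by
    simpa using (hasDerivAt_id s).const_mul v
  have h2 := key (fun s => v * s) (fun _ => v) hid
  have h3 := key (fun s => v * s * (v * s) + v) (fun s => v * (v * s) + v * s * v)
    (fun s => ((hid s).mul (hid s)).add_const v)
  have h4 := key (fun s => v * s * (v * s * (v * s) + v) + (v * (v * s) + v * s * v))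
    (fun s => (v * (v * s * (v * s) + v) + v * s * (v * (v * s) + v * s * v)) +
      (v * v + v * v))
    (fun s => ((hid s).mul (((hid s).mul (hid s)).add_const v)).add
      (((hid s).const_mul v).add ((hid s).mul_const v)))
  rw [iteratedDeriv_succ, iteratedDeriv_succ, iteratedDeriv_succ, iteratedDeriv_one, h1, h2, h3, h4]
  simp
  ring

/-- The fourth moment of a centred real Gaussian variable. -/
lemma integral_pow_four_of_hasGaussianLaw {Ω : Type*} [MeasurableSpace Ω] {P : Measure Ω}
    {X : Ω → ℝ} (hX : HasGaussianLaw X P) (h0 : ∫ ω, X ω ∂P = 0) :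
    ∫ ω, X ω ^ 4 ∂P = 3 * (∫ ω, X ω ^ 2 ∂P) ^ 2 := by
  have hmap := hX.map_eq_gaussianReal
  rw [h0] at hmap
  have hv : Var[X; P] = ∫ ω, X ω ^ 2 ∂P := by
    rw [variance_eq_integral hX.aemeasurable, h0]; simp
  have hm : mgf X P = fun s => Real.exp (Var[X; P] * s ^ 2 / 2) := by
    funext s
    rw [mgf_gaussianReal hmap s, Real.coe_toNNReal _ (variance_nonneg _ _)]
    simp
  have hset : integrableExpSet X P = Set.univ := by
    have : integrableExpSet (id : ℝ → ℝ) (P.map X) = Set.univ := by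
      rw [hmap]; exact integrableExpSet_id_gaussianReal
    ext s
    have hs : s ∈ integrableExpSet (id : ℝ → ℝ) (P.map X) := by rw [this]; trivial
    simp only [Set.mem_univ, iff_true]
    exact (integrable_map_measure (by fun_prop) hX.aemeasurable).1 hs
  have := iteratedDeriv_mgf_zero (X := X) (μ := P) (by rw [hset]; simp) 4
  rw [hm, iteratedDeriv_four_exp_mul_sq, hv] at this
  simpa using this.symm

/-! ### Isserlis' formula by polarization -/

section Isserlis

variable {Ω E : Type*} [MeasurableSpace Ω] {P : Measure Ω} [NormedAddCommGroup E]
  [NormedSpace ℝ E] [MeasurableSpace E] [BorelSpace E] {Z : Ω → E}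

lemma integrable_dual_mul_dual (hZ : HasGaussianLaw Z P) (A B : StrongDual ℝ E) :
    Integrable (fun ω => A (Z ω) * B (Z ω)) P :=
  (hZ.map_fun A).memLp_two.integrable_mul (hZ.map_fun B).memLp_two

lemma integral_dual_add_mul_add (hZ : HasGaussianLaw Z P) (A B C D : StrongDual ℝ E) :
    ∫ ω, (A + B) (Z ω) * (C + D) (Z ω) ∂P =
      ∫ ω, A (Z ω) * C (Z ω) ∂P + ∫ ω, A (Z ω) * D (Z ω) ∂P +
        (∫ ω, B (Z ω) * C (Z ω) ∂P + ∫ ω, B (Z ω) * D (Z ω) ∂P) := by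
  have hI2 := fun C D => integrable_dual_mul_dual hZ C D
  rw [← integral_add (hI2 _ _) (hI2 _ _), ← integral_add (hI2 _ _) (hI2 _ _),
    ← integral_add ((hI2 _ _).fun_add (hI2 _ _)) ((hI2 _ _).fun_add (hI2 _ _))]
  congr 1 with ω
  simp only [_root_.add_apply]
  ring

variable [CompleteSpace E] [SecondCountableTopology E]

/-- The product is dominated by a multiple of `‖Z‖ ^ 4`, and Gaussian laws have moments of every
finite order. -/
lemma integrable_dual_mul_four (hZ : HasGaussianLaw Z P) (A B C D : StrongDual ℝ E) :
    Integrable (fun ω => A (Z ω) * B (Z ω) * (C (Z ω) * D (Z ω))) P := by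
  have := hZ.isProbabilityMeasure
  have hn : Integrable (fun ω => ‖Z ω‖ ^ 4) P :=
    (hZ.memLp (p := 4) (by simp)).integrable_norm_pow (by norm_num)
  have hm : ∀ L : StrongDual ℝ E, AEStronglyMeasurable (fun ω => L (Z ω)) P := fun L =>
    (hZ.map_fun L).aemeasurable.aestronglyMeasurable
  refine (hn.const_mul (‖A‖ * ‖B‖ * (‖C‖ * ‖D‖))).mono'
    (((hm A).mul (hm B)).mul ((hm C).mul (hm D))) (Filter.Eventually.of_forall fun ω => ?_)
  simp only [norm_mul]
  calc _ ≤ (‖A‖ * ‖Z ω‖) * (‖B‖ * ‖Z ω‖) * ((‖C‖ * ‖Z ω‖) * (‖D‖ * ‖Z ω‖)) := by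
        gcongr <;> exact ContinuousLinearMap.le_opNorm _ _
    _ = _ := by ring

/-- Integrate `(a + b)⁴ + (a - b)⁴ = 2a⁴ + 12a²b² + 2b⁴`; the fourth-moment formula for `A`, `B`, `A
+ B` and `A - B` leaves one unknown. -/
lemma integral_dual_sq_mul_sq (hZ : HasGaussianLaw Z P)
    (h0 : ∀ L : StrongDual ℝ E, ∫ ω, L (Z ω) ∂P = 0) (A B : StrongDual ℝ E) :
    ∫ ω, A (Z ω) * A (Z ω) * (B (Z ω) * B (Z ω)) ∂P =
      (∫ ω, A (Z ω) * A (Z ω) ∂P) * (∫ ω, B (Z ω) * B (Z ω) ∂P) +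
        2 * (∫ ω, A (Z ω) * B (Z ω) ∂P) ^ 2 := by
  have hI2 := fun C D => integrable_dual_mul_dual hZ C D
  have hI4 := fun C D F G => integrable_dual_mul_four hZ C D F G
  have h4 : ∀ L : StrongDual ℝ E, ∫ ω, L (Z ω) * L (Z ω) * (L (Z ω) * L (Z ω)) ∂P =
      3 * (∫ ω, L (Z ω) * L (Z ω) ∂P) ^ 2 := fun L => by
    have := integral_pow_four_of_hasGaussianLaw (hZ.map_fun L) (h0 L)
    simp only [pow_two] at this ⊢
    rw [← this]
    congr 1 with ω
    ring
  have hsum : ∫ ω, (A + B) (Z ω) * (A + B) (Z ω) * ((A + B) (Z ω) * (A + B) (Z ω)) ∂P +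
      ∫ ω, (A - B) (Z ω) * (A - B) (Z ω) * ((A - B) (Z ω) * (A - B) (Z ω)) ∂P =
      2 * ∫ ω, A (Z ω) * A (Z ω) * (A (Z ω) * A (Z ω)) ∂P +
      12 * ∫ ω, A (Z ω) * A (Z ω) * (B (Z ω) * B (Z ω)) ∂P +
      2 * ∫ ω, B (Z ω) * B (Z ω) * (B (Z ω) * B (Z ω)) ∂P := by
    rw [← integral_add (hI4 _ _ _ _) (hI4 _ _ _ _), ← integral_const_mul, ← integral_const_mul,
      ← integral_const_mul, ← integral_add ((hI4 _ _ _ _).const_mul _) ((hI4 _ _ _ _).const_mul _),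
      ← integral_add (((hI4 _ _ _ _).const_mul _).fun_add ((hI4 _ _ _ _).const_mul _))
        ((hI4 _ _ _ _).const_mul _)]
    congr 1 with ω
    simp only [_root_.add_apply, _root_.sub_apply]
    ring
  have hadd : ∫ ω, (A + B) (Z ω) * (A + B) (Z ω) ∂P = ∫ ω, A (Z ω) * A (Z ω) ∂P +
      2 * ∫ ω, A (Z ω) * B (Z ω) ∂P + ∫ ω, B (Z ω) * B (Z ω) ∂P := by
    rw [← integral_const_mul, ← integral_add (hI2 _ _) ((hI2 _ _).const_mul _),
      ← integral_add ((hI2 _ _).fun_add ((hI2 _ _).const_mul _)) (hI2 _ _)]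
    congr 1 with ω
    simp only [_root_.add_apply]
    ring
  have hsub : ∫ ω, (A - B) (Z ω) * (A - B) (Z ω) ∂P = ∫ ω, A (Z ω) * A (Z ω) ∂P +
      ∫ ω, B (Z ω) * B (Z ω) ∂P - 2 * ∫ ω, A (Z ω) * B (Z ω) ∂P := by
    rw [← integral_const_mul, ← integral_add (hI2 _ _) (hI2 _ _),
      ← integral_sub ((hI2 _ _).fun_add (hI2 _ _)) ((hI2 _ _).const_mul _)]
    congr 1 with ω
    simp only [_root_.sub_apply]
    ring
  rw [h4, h4, h4, h4, hadd, hsub] at hsum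
  linarith

/-- Isserlis' formula for four linear functionals of a centred Gaussian vector. -/
lemma integral_dual_mul_four (hZ : HasGaussianLaw Z P)
    (h0 : ∀ L : StrongDual ℝ E, ∫ ω, L (Z ω) ∂P = 0) (A B C D : StrongDual ℝ E) :
    ∫ ω, A (Z ω) * B (Z ω) * (C (Z ω) * D (Z ω)) ∂P =
      (∫ ω, A (Z ω) * B (Z ω) ∂P) * (∫ ω, C (Z ω) * D (Z ω) ∂P) +
      (∫ ω, A (Z ω) * C (Z ω) ∂P) * (∫ ω, B (Z ω) * D (Z ω) ∂P) +
      (∫ ω, A (Z ω) * D (Z ω) ∂P) * (∫ ω, B (Z ω) * C (Z ω) ∂P) := by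
  have hI4 := fun C D F G => integrable_dual_mul_four hZ C D F G
  have hsq := integral_dual_sq_mul_sq hZ h0
  have hneg : ∀ F G : StrongDual ℝ E,
      ∫ ω, F (Z ω) * (-G) (Z ω) ∂P = -∫ ω, F (Z ω) * G (Z ω) ∂P := fun F G => by
    rw [← integral_neg]; simp
  have hneg' : ∀ F G : StrongDual ℝ E,
      ∫ ω, (-F) (Z ω) * G (Z ω) ∂P = -∫ ω, F (Z ω) * G (Z ω) ∂P := fun F G => by
    rw [← integral_neg]; simp
  have hcomm : ∀ F G : StrongDual ℝ E,
      ∫ ω, F (Z ω) * G (Z ω) ∂P = ∫ ω, G (Z ω) * F (Z ω) ∂P := fun F G => by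
    simp only [mul_comm]
  -- This is the product of `4ab = (a + b)² - (a - b)²` and the same identity for `c`, `d`; each
  -- term is then a product of two squares.
  have hpol : 16 * ∫ ω, A (Z ω) * B (Z ω) * (C (Z ω) * D (Z ω)) ∂P =
      ∫ ω, (A + B) (Z ω) * (A + B) (Z ω) * ((C + D) (Z ω) * (C + D) (Z ω)) ∂P
      + ∫ ω, (A + -B) (Z ω) * (A + -B) (Z ω) * ((C + -D) (Z ω) * (C + -D) (Z ω)) ∂P
      - (∫ ω, (A + B) (Z ω) * (A + B) (Z ω) * ((C + -D) (Z ω) * (C + -D) (Z ω)) ∂P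
      + ∫ ω, (A + -B) (Z ω) * (A + -B) (Z ω) * ((C + D) (Z ω) * (C + D) (Z ω)) ∂P) := by
    rw [← integral_add (hI4 _ _ _ _) (hI4 _ _ _ _), ← integral_add (hI4 _ _ _ _) (hI4 _ _ _ _),
      ← integral_sub ((hI4 _ _ _ _).fun_add (hI4 _ _ _ _)) ((hI4 _ _ _ _).fun_add (hI4 _ _ _ _)),
      ← integral_const_mul]
    congr 1 with ω
    simp only [_root_.add_apply, _root_.neg_apply]
    ring
  rw [hsq, hsq, hsq, hsq] at hpol
  simp only [integral_dual_add_mul_add hZ, hneg, hneg'] at hpol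
  rw [hcomm B A, hcomm D C] at hpol
  linarith

end Isserlis

/-! ### Quadratic forms and the Loewner order -/

section MatrixBounds

variable {n : ℕ}

/-- Cauchy–Schwarz over pairs of indices, applied to `A i j` and `v i * v j`. -/
lemma quadForm_sq_le (A : Matrix (Fin n) (Fin n) ℝ) (v : Fin n → ℝ) :
    (v ⬝ᵥ (A *ᵥ v)) ^ 2 ≤ (∑ i, ∑ j, A i j ^ 2) * (v ⬝ᵥ v) ^ 2 := by
  have h := Finset.sum_mul_sq_le_sq_mul_sq (Finset.univ : Finset (Fin n × Fin n))
    (fun q => A q.1 q.2) (fun q => v q.1 * v q.2)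
  have h1 : ∑ q : Fin n × Fin n, A q.1 q.2 * (v q.1 * v q.2) = v ⬝ᵥ (A *ᵥ v) := by
    simp only [Fintype.sum_prod_type, dotProduct, mulVec, Finset.mul_sum]
    exact Finset.sum_congr rfl fun i _ => Finset.sum_congr rfl fun j _ => by ring
  have h2 : ∑ q : Fin n × Fin n, (v q.1 * v q.2) ^ 2 = (v ⬝ᵥ v) ^ 2 := by
    simp only [Fintype.sum_prod_type, dotProduct, pow_two, Finset.sum_mul_sum]
    exact Finset.sum_congr rfl fun i _ => Finset.sum_congr rfl fun j _ => by ring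
  rw [h1, h2, Fintype.sum_prod_type] at h
  exact h

lemma quadForm_le_add_of_sum_sq_le {A B : Matrix (Fin n) (Fin n) ℝ} {c : ℝ} (hc : 0 ≤ c)
    (h : ∑ i, ∑ j, (A i j - B i j) ^ 2 ≤ c ^ 2) (v : Fin n → ℝ) :
    v ⬝ᵥ (B *ᵥ v) ≤ v ⬝ᵥ ((A + c • (1 : Matrix (Fin n) (Fin n) ℝ)) *ᵥ v) := by
  have h1 := quadForm_sq_le (A - B) v
  have hv : 0 ≤ v ⬝ᵥ v := Finset.sum_nonneg fun i _ => mul_self_nonneg _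
  have h2 : (v ⬝ᵥ ((A - B) *ᵥ v)) ^ 2 ≤ (c * (v ⬝ᵥ v)) ^ 2 := by
    rw [mul_pow]
    exact h1.trans (mul_le_mul_of_nonneg_right h (sq_nonneg _))
  have h3 := (abs_le_of_sq_le_sq' h2 (mul_nonneg hc hv)).1
  rw [sub_mulVec, dotProduct_sub] at h3
  rw [add_mulVec, dotProduct_add, smul_mulVec, one_mulVec, dotProduct_smul, smul_eq_mul]
  linarith

/-- If `S²` is dominated by `M`, then `S` maps the ball of squared radius `r` into the ellipsoid
`{z | zᵀ M⁻¹ z ≤ r}`. -/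
lemma dotProduct_inv_mulVec_le {S M : Matrix (Fin n) (Fin n) ℝ} (hS : Sᵀ = S) (hM : M.PosDef)
    (hle : ∀ v : Fin n → ℝ, v ⬝ᵥ ((S * S) *ᵥ v) ≤ v ⬝ᵥ (M *ᵥ v)) {ξ : Fin n → ℝ} {r : ℝ}
    (hξ : ξ ⬝ᵥ ξ ≤ r) : (S *ᵥ ξ) ⬝ᵥ (M⁻¹ *ᵥ (S *ᵥ ξ)) ≤ r := by
  set y := M⁻¹ *ᵥ (S *ᵥ ξ) with hy
  have hMy : M *ᵥ y = S *ᵥ ξ := by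
    rw [hy, mulVec_mulVec, mul_nonsing_inv _ ((isUnit_iff_isUnit_det M).1 hM.isUnit), one_mulVec]
  have hsymm : ∀ a b : Fin n → ℝ, (S *ᵥ a) ⬝ᵥ b = a ⬝ᵥ (S *ᵥ b) := fun a b => by
    rw [dotProduct_comm, dotProduct_mulVec, ← mulVec_transpose, hS, dotProduct_comm]
  have hq : (S *ᵥ ξ) ⬝ᵥ y = y ⬝ᵥ (M *ᵥ y) := by rw [hMy, dotProduct_comm]
  have hq0 : 0 ≤ (S *ᵥ ξ) ⬝ᵥ y := by
    rw [hq]; simpa using hM.posSemidef.dotProduct_mulVec_nonneg y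
  -- With `q = (Sξ)ᵀy = yᵀMy`, Cauchy–Schwarz and `yᵀS²y ≤ yᵀMy` give `q² ≤ r q`, hence `q ≤ r`.
  have hcs : ((S *ᵥ ξ) ⬝ᵥ y) ^ 2 ≤ (ξ ⬝ᵥ ξ) * ((S *ᵥ y) ⬝ᵥ (S *ᵥ y)) := by
    rw [hsymm]
    simpa [dotProduct, pow_two] using Finset.sum_mul_sq_le_sq_mul_sq Finset.univ ξ (S *ᵥ y)
  have hSy : (S *ᵥ y) ⬝ᵥ (S *ᵥ y) ≤ (S *ᵥ ξ) ⬝ᵥ y := by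
    rw [hq, hsymm, mulVec_mulVec]; exact hle y
  have hSy0 : 0 ≤ (S *ᵥ y) ⬝ᵥ (S *ᵥ y) := Finset.sum_nonneg fun i _ => mul_self_nonneg _
  have hr : 0 ≤ r := le_trans (Finset.sum_nonneg fun i _ => mul_self_nonneg _) hξ
  by_contra! hlt
  nlinarith [mul_le_mul hξ hSy hSy0 hr]

lemma diag_le_of_posSemidef_sub {S : Matrix (Fin n) (Fin n) ℝ} {σ : ℝ}
    (h : (σ • (1 : Matrix (Fin n) (Fin n) ℝ) - S).PosSemidef) (i : Fin n) : S i i ≤ σ := by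
  have := h.diag_nonneg (i := i)
  simp at this
  linarith

open scoped MatrixOrder in
lemma transpose_sqrt (S : Matrix (Fin n) (Fin n) ℝ) : (CFC.sqrt S)ᵀ = CFC.sqrt S := by
  have : IsSelfAdjoint (CFC.sqrt S) := (CFC.sqrt_nonneg S).isSelfAdjoint
  simpa [IsSelfAdjoint, star_eq_conjTranspose, conjTranspose_eq_transpose_of_trivial] using this

open scoped MatrixOrder in
lemma sqrt_mul_sqrt {S : Matrix (Fin n) (Fin n) ℝ} (hS : S.PosSemidef) :
    CFC.sqrt S * CFC.sqrt S = S :=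
  CFC.sqrt_mul_sqrt_self _ hS.nonneg

open scoped MatrixOrder in
-- Conjugating `σI - S` by `√S` gives `σS - S² ⪰ 0`. Its diagonal bounds the square sum of row `i`
-- by `σ S i i ≤ σ²`.
lemma sum_sq_le_of_posSemidef_sub {S : Matrix (Fin n) (Fin n) ℝ} {σ : ℝ} (hσ : 0 ≤ σ)
    (hS : S.PosSemidef) (h : (σ • (1 : Matrix (Fin n) (Fin n) ℝ) - S).PosSemidef) :
    ∑ i, ∑ j, S i j ^ 2 ≤ n * σ ^ 2 := by
  have hp := h.mul_mul_conjTranspose_same (CFC.sqrt S)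
  have he : CFC.sqrt S * (σ • (1 : Matrix (Fin n) (Fin n) ℝ) - S) * (CFC.sqrt S)ᴴ
      = σ • S - S * S := by
    rw [conjTranspose_eq_transpose_of_trivial, transpose_sqrt, mul_sub, sub_mul]
    congr 1
    · simp [sqrt_mul_sqrt hS]
    · nth_rw 2 [← sqrt_mul_sqrt hS]
      simp only [← mul_assoc]
      rw [sqrt_mul_sqrt hS, mul_assoc, sqrt_mul_sqrt hS]
  rw [he] at hp
  have hrow : ∀ i, ∑ j, S i j ^ 2 ≤ σ ^ 2 := fun i => by
    have h1 := hp.diag_nonneg (i := i)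
    have h2 : (S * S) i i = ∑ j, S i j ^ 2 := by
      rw [mul_apply]
      exact Finset.sum_congr rfl fun j _ => by
        rw [pow_two, show S j i = S i j by simpa using hS.isHermitian.apply i j]
    rw [Matrix.sub_apply, Matrix.smul_apply, smul_eq_mul, h2] at h1
    nlinarith [diag_le_of_posSemidef_sub h i]
  calc ∑ i, ∑ j, S i j ^ 2 ≤ ∑ _i : Fin n, σ ^ 2 := Finset.sum_le_sum fun i _ => hrow i
    _ = n * σ ^ 2 := by simp

lemma sum_diag_mul_diag_le {S : Matrix (Fin n) (Fin n) ℝ} {σ : ℝ}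
    (hS : S.PosSemidef) (h : (σ • (1 : Matrix (Fin n) (Fin n) ℝ) - S).PosSemidef) :
    ∑ i, ∑ j, S i i * S j j ≤ (n * σ) ^ 2 := by
  rw [← Finset.sum_mul_sum, ← pow_two]
  have h0 : 0 ≤ ∑ i, S i i := Finset.sum_nonneg fun i _ => hS.diag_nonneg
  have h1 : ∑ i, S i i ≤ n * σ := by
    calc ∑ i, S i i ≤ ∑ _i : Fin n, σ := Finset.sum_le_sum fun i _ => diag_le_of_posSemidef_sub h i
      _ = n * σ := by simp
  exact pow_le_pow_left₀ h0 h1 2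

lemma empCov_posSemidef (w : ℕ → Vec n) {t : ℕ} (ht : 1 ≤ t) : (empCov w t).PosSemidef := by
  refine PosSemidef.smul (posSemidef_sum _ fun k _ => ?_) ?_
  · simpa using posSemidef_vecMulVec_self_star (w k - empMean w t).ofLp
  · have : (1 : ℝ) ≤ t := by exact_mod_cast ht
    exact one_div_nonneg.2 (by linarith)

/-- The empirical covariance may be singular; the added multiple of the identity is positive exactly
because `n > 0`. -/
lemma inflatedCov_posDef (w : ℕ → Vec n) {t : ℕ} (ht : 2 ≤ t) (hn : 0 < n) {σ δ : ℝ} (hσ : 0 < σ)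
    (hδ : 0 < δ) : (inflatedCov σ δ w t).PosDef := by
  have : (2 : ℝ) ≤ t := by exact_mod_cast ht
  have hn' : (0 : ℝ) < n := by exact_mod_cast hn
  refine PosDef.posSemidef_add (empCov_posSemidef w (by omega)) (PosDef.smul PosDef.one ?_)
  have : 0 < δ * ((t : ℝ) - 1) := mul_pos hδ (by linarith)
  positivity

end MatrixBounds

/-! ### Moments of the empirical mean and covariance -/

section Moments

variable {n : ℕ} {ι Ω : Type*} [MeasurableSpace Ω] {P : Measure Ω}
  {Z : ι → Ω → Vec n} {S : Matrix (Fin n) (Fin n) ℝ}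

lemma hasLaw_sub_const {μ : Vec n} {X : Ω → Vec n}
    (hX : HasLaw X (multivariateGaussian μ S) P) :
    HasLaw (fun ω => X ω - μ) (multivariateGaussian 0 S) P := by
  refine HasLaw.fun_comp (Y := fun x => x - μ) ⟨by fun_prop, ?_⟩ hX
  simp only [multivariateGaussian]
  rw [Measure.map_map (by fun_prop) (by fun_prop)]
  congr 1 with x
  simp

lemma integral_coord_mul_coord (hS : S.PosSemidef) {X : Ω → Vec n}
    (hX : HasLaw X (multivariateGaussian 0 S) P) (i j : Fin n) :
    ∫ ω, X ω i * X ω j ∂P = S i j := by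
  have h0 : ∀ i : Fin n, ∫ x : Vec n, x i ∂(multivariateGaussian 0 S) = 0 := fun i => by
    have h := (EuclideanSpace.proj (𝕜 := ℝ) (ι := Fin n) i).integral_comp_comm
      (IsGaussian.integrable_fun_id (μ := multivariateGaussian (0 : Vec n) S))
    rw [integral_id_multivariateGaussian] at h
    simpa using h
  have h1 := covariance_eval_multivariateGaussian (μ := (0 : Vec n)) hS i j
  rw [covariance, h0, h0] at h1
  simp only [sub_zero] at h1
  rw [← h1]
  exact hX.integral_comp (f := fun x : Vec n => x i * x j) (by fun_prop)

lemma integral_eq_zero_of_hasLaw {X : Ω → Vec n}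
    (hX : HasLaw X (multivariateGaussian 0 S) P) : ∫ ω, X ω ∂P = 0 := by
  rw [hX.integral_eq, integral_id_multivariateGaussian]

lemma integral_coord_eq_zero {X : Ω → Vec n}
    (hX : HasLaw X (multivariateGaussian 0 S) P) (i : Fin n) : ∫ ω, X ω i ∂P = 0 := by
  have h := (EuclideanSpace.proj (𝕜 := ℝ) (ι := Fin n) i).integral_comp_comm
    hX.hasGaussianLaw.integrable
  rw [integral_eq_zero_of_hasLaw hX] at h
  simpa using h

lemma integral_coord_mul_coord_of_iIndepFun [DecidableEq ι] (hS : S.PosSemidef) (hI : iIndepFun Z P)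
    (hL : ∀ k, HasLaw (Z k) (multivariateGaussian 0 S) P) (k l : ι) (i j : Fin n) :
    ∫ ω, Z k ω i * Z l ω j ∂P = if k = l then S i j else 0 := by
  split_ifs with h
  · subst h
    exact integral_coord_mul_coord hS (hL k) i j
  · have hind : IndepFun (fun ω => Z k ω i) (fun ω => Z l ω j) P :=
      (hI.indepFun h).comp (φ := fun x : Vec n => x i) (ψ := fun x : Vec n => x j)
        (by fun_prop) (by fun_prop)
    have hm : ∀ k i, AEStronglyMeasurable (fun ω => Z k ω i) P := fun k i =>
      (show Measurable fun x : Vec n => x i by fun_prop).comp_aemeasurable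
        (hL k).aemeasurable |>.aestronglyMeasurable
    have := hind.integral_mul_eq_mul_integral (hm k i) (hm l j)
    simpa [integral_coord_eq_zero (hL k)] using this

variable [Fintype ι]

/-- The functional `z ↦ ∑ k, c k * (z k) i` on families of vectors. -/
noncomputable def coordSum (c : ι → ℝ) (i : Fin n) : StrongDual ℝ (ι → Vec n) :=
  ∑ k, c k • (EuclideanSpace.proj i).comp (ContinuousLinearMap.proj k)

lemma coordSum_apply (c : ι → ℝ) (i : Fin n) (z : ι → Vec n) :
    coordSum c i z = ∑ k, c k * z k i := by
  simp [coordSum]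

lemma hasGaussianLaw_family (hI : iIndepFun Z P)
    (hL : ∀ k, HasLaw (Z k) (multivariateGaussian 0 S) P) :
    HasGaussianLaw (fun ω k => Z k ω) P :=
  iIndepFun.hasGaussianLaw (fun k => (hL k).hasGaussianLaw) hI

lemma integral_dual_family (hI : iIndepFun Z P)
    (hL : ∀ k, HasLaw (Z k) (multivariateGaussian 0 S) P) (L : StrongDual ℝ (ι → Vec n)) :
    ∫ ω, L (fun k => Z k ω) ∂P = 0 := by
  have h : ∫ ω, (fun k => Z k ω) ∂P = 0 := by
    funext k
    rw [eval_integral fun k => (hL k).hasGaussianLaw.integrable]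
    exact integral_eq_zero_of_hasLaw (hL k)
  rw [L.integral_comp_comm (hasGaussianLaw_family hI hL).integrable, h, map_zero]

/-- In the double sum, independence and centring kill the terms with `k ≠ l`. -/
lemma integral_coordSum_mul_coordSum (hS : S.PosSemidef) (hI : iIndepFun Z P)
    (hL : ∀ k, HasLaw (Z k) (multivariateGaussian 0 S) P) (c c' : ι → ℝ) (i j : Fin n) :
    ∫ ω, coordSum c i (fun k => Z k ω) * coordSum c' j (fun k => Z k ω) ∂P =
      (c ⬝ᵥ c') * S i j := by
  classical
  have hint : ∀ k l, Integrable (fun ω => c k * c' l * (Z k ω i * Z l ω j)) P := fun k l => by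
    have := integrable_dual_mul_dual (hasGaussianLaw_family hI hL)
      (coordSum (Pi.single k 1) i) (coordSum (Pi.single l 1) j)
    simp only [coordSum_apply, Pi.single_apply, ite_mul, one_mul, zero_mul, Finset.sum_ite_eq',
      Finset.mem_univ, if_true] at this
    exact this.const_mul _
  have he : ∀ ω, coordSum c i (fun k => Z k ω) * coordSum c' j (fun k => Z k ω) =
      ∑ k, ∑ l, c k * c' l * (Z k ω i * Z l ω j) := fun ω => by
    rw [coordSum_apply, coordSum_apply, Finset.sum_mul_sum]
    exact Finset.sum_congr rfl fun k _ => Finset.sum_congr rfl fun l _ => by ring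
  simp_rw [he]
  rw [integral_finsetSum _ fun k _ => integrable_finsetSum _ fun l _ => hint k l]
  simp_rw [integral_finsetSum _ fun l _ => hint _ l, integral_const_mul,
    integral_coord_mul_coord_of_iIndepFun hS hI hL]
  simp [dotProduct, Finset.sum_mul]

/-- The mean of the entries of `∑ k, Y k (Y k)ᵀ`, where the `Y k` are linear
combinations, with coefficients `C k`, of independent centred Gaussian vectors. -/
lemma integral_gram (hS : S.PosSemidef) (hI : iIndepFun Z P)
    (hL : ∀ k, HasLaw (Z k) (multivariateGaussian 0 S) P) (C : ι → ι → ℝ) (i j : Fin n) :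
    ∫ ω, ∑ k, coordSum (C k) i (fun k => Z k ω) * coordSum (C k) j (fun k => Z k ω) ∂P =
      (∑ k, C k ⬝ᵥ C k) * S i j := by
  rw [integral_finsetSum _ fun k _ => integrable_dual_mul_dual (hasGaussianLaw_family hI hL) _ _]
  simp_rw [integral_coordSum_mul_coordSum hS hI hL, Finset.sum_mul]

lemma gram_sq (C : ι → ι → ℝ) (i j : Fin n) (z : ι → Vec n) :
    (∑ k, coordSum (C k) i z * coordSum (C k) j z) ^ 2 =
      ∑ k, ∑ l, coordSum (C k) i z * coordSum (C k) j z *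
        (coordSum (C l) i z * coordSum (C l) j z) := by
  rw [pow_two, Finset.sum_mul_sum]

lemma integrable_gram (hI : iIndepFun Z P)
    (hL : ∀ k, HasLaw (Z k) (multivariateGaussian 0 S) P) (C : ι → ι → ℝ) (i j : Fin n) :
    Integrable (fun ω => ∑ k, coordSum (C k) i (fun k => Z k ω) *
      coordSum (C k) j (fun k => Z k ω)) P :=
  integrable_finsetSum _ fun _ _ => integrable_dual_mul_dual (hasGaussianLaw_family hI hL) _ _

lemma integrable_gram_sq (hI : iIndepFun Z P)
    (hL : ∀ k, HasLaw (Z k) (multivariateGaussian 0 S) P) (C : ι → ι → ℝ) (i j : Fin n) :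
    Integrable (fun ω => (∑ k, coordSum (C k) i (fun k => Z k ω) *
      coordSum (C k) j (fun k => Z k ω)) ^ 2) P := by
  simp_rw [gram_sq]
  exact integrable_finsetSum _ fun _ _ => integrable_finsetSum _ fun _ _ =>
    integrable_dual_mul_four (hasGaussianLaw_family hI hL) _ _ _ _

/-- Isserlis on each term of the double sum: the pairing within `k` and within `l` yields the
squared mean, the two cross pairings yield the factor `(C k ⬝ᵥ C l) ^ 2`. -/
lemma integral_gram_sq (hS : S.PosSemidef) (hI : iIndepFun Z P)
    (hL : ∀ k, HasLaw (Z k) (multivariateGaussian 0 S) P) (C : ι → ι → ℝ) (i j : Fin n) :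
    ∫ ω, (∑ k, coordSum (C k) i (fun k => Z k ω) * coordSum (C k) j (fun k => Z k ω)) ^ 2 ∂P =
      (∑ k, C k ⬝ᵥ C k) ^ 2 * S i j ^ 2 +
        (∑ k, ∑ l, (C k ⬝ᵥ C l) ^ 2) * (S i i * S j j + S i j ^ 2) := by
  have hG := hasGaussianLaw_family hI hL
  simp_rw [gram_sq]
  rw [integral_finsetSum _ fun k _ => integrable_finsetSum _ fun l _ =>
    integrable_dual_mul_four hG _ _ _ _]
  simp_rw [integral_finsetSum _ fun l _ => integrable_dual_mul_four hG _ _ _ _,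
    integral_dual_mul_four hG (integral_dual_family hI hL),
    integral_coordSum_mul_coordSum hS hI hL]
  have hsym : S j i = S i j := by simpa using hS.isHermitian.apply i j
  rw [hsym, pow_two (∑ k, C k ⬝ᵥ C k), Finset.sum_mul_sum, Finset.sum_mul, Finset.sum_mul,
    ← Finset.sum_add_distrib]
  refine Finset.sum_congr rfl fun k _ => ?_
  rw [Finset.sum_mul, Finset.sum_mul, ← Finset.sum_add_distrib]
  exact Finset.sum_congr rfl fun l _ => by ring

/-- The coefficients of the projection that subtracts the average. -/
noncomputable def centering (t : ℕ) (k l : Fin t) : ℝ := (if k = l then 1 else 0) - 1 / (t : ℝ)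

/-- The centering matrix is a symmetric idempotent. Its trace and its squared Frobenius norm
therefore agree. -/
lemma centering_dotProduct {t : ℕ} (ht : 0 < t) (k l : Fin t) :
    centering t k ⬝ᵥ centering t l = centering t k l := by
  have : (t : ℝ) ≠ 0 := by positivity
  simp only [dotProduct, centering, sub_mul, mul_sub, Finset.sum_sub_distrib, ite_mul, mul_ite,
    one_mul, zero_mul, mul_one, mul_zero, Finset.sum_ite_eq, Finset.mem_univ, if_true]
  simp only [Finset.sum_const, Finset.card_univ, Fintype.card_fin,
    nsmul_eq_mul]
  field_simp
  ring

lemma sum_centering_diag {t : ℕ} (ht : 0 < t) : ∑ k, centering t k k = (t : ℝ) - 1 := by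
  have : (t : ℝ) ≠ 0 := by positivity
  simp [centering]
  field_simp

lemma sum_centering_sq {t : ℕ} (ht : 0 < t) : ∑ k, ∑ l, centering t k l ^ 2 = (t : ℝ) - 1 := by
  rw [← sum_centering_diag ht]
  refine Finset.sum_congr rfl fun k _ => ?_
  rw [← centering_dotProduct ht k k]
  simp [dotProduct, pow_two]

lemma coordSum_centering {t : ℕ} (k : Fin t) (i : Fin n) (z : Fin t → Vec n) :
    coordSum (centering t k) i z = z k i - 1 / (t : ℝ) * ∑ l, z l i := by
  rw [coordSum_apply]
  simp [centering, sub_mul, Finset.sum_sub_distrib, Finset.mul_sum]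

lemma empMean_apply (w : ℕ → Vec n) (t : ℕ) (i : Fin n) :
    empMean w t i = 1 / (t : ℝ) * ∑ l : Fin t, w l i := by
  simp [empMean, Finset.sum_range]

lemma empMean_sub_apply (w : ℕ → Vec n) {t : ℕ} (ht : 0 < t) (μ : Vec n) (i : Fin n) :
    (empMean w t - μ) i = coordSum (fun _ : Fin t => 1 / (t : ℝ)) i (fun k => w k - μ) := by
  have : (t : ℝ) ≠ 0 := by positivity
  rw [PiLp.sub_apply, empMean_apply, coordSum_apply, ← Finset.mul_sum]
  simp
  field_simp

/-- Centering annihilates constants, so `μ` may be subtracted from the samples, which reduces to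
centred vectors. -/
lemma empCov_apply (w : ℕ → Vec n) {t : ℕ} (ht : 0 < t) (μ : Vec n) (i j : Fin n) :
    empCov w t i j = 1 / ((t : ℝ) - 1) * ∑ k : Fin t,
      coordSum (centering t k) i (fun k => w k - μ) *
        coordSum (centering t k) j (fun k => w k - μ) := by
  have : (t : ℝ) ≠ 0 := by positivity
  have h : ∀ (k : Fin t) (i : Fin n), coordSum (centering t k) i (fun k => w k - μ) =
      (w k - empMean w t) i := fun k i => by
    change _ = w k i - empMean w t i
    rw [coordSum_centering, empMean_apply]
    simp
    field_simp
    ring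
  simp [h, empCov, Finset.sum_range, Matrix.sum_apply, vecMulVec_apply]

section Estimators

variable {w : ℕ → Ω → Vec n} {μ : Vec n} {t : ℕ}

lemma integrable_empMean_sub_sq (hI : iIndepFun w P)
    (hL : ∀ k, HasLaw (w k) (multivariateGaussian μ S) P) (ht : 0 < t) (i : Fin n) :
    Integrable (fun ω => (empMean (fun k => w k ω) t - μ) i ^ 2) P := by
  have hI' : iIndepFun (fun (k : Fin t) ω => w k ω - μ) P :=
    (hI.precomp Fin.val_injective).comp (fun _ x => x - μ) (by fun_prop)
  simp_rw [empMean_sub_apply _ ht, pow_two]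
  exact integrable_dual_mul_dual
    (hasGaussianLaw_family hI' fun k : Fin t => hasLaw_sub_const (hL k)) _ _

lemma integral_empMean_sub_sq (hS : S.PosSemidef) (hI : iIndepFun w P)
    (hL : ∀ k, HasLaw (w k) (multivariateGaussian μ S) P) (ht : 0 < t) (i : Fin n) :
    ∫ ω, (empMean (fun k => w k ω) t - μ) i ^ 2 ∂P = S i i / t := by
  have hI' : iIndepFun (fun (k : Fin t) ω => w k ω - μ) P :=
    (hI.precomp Fin.val_injective).comp (fun _ x => x - μ) (by fun_prop)
  have : (t : ℝ) ≠ 0 := by positivity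
  simp_rw [empMean_sub_apply _ ht, pow_two]
  rw [integral_coordSum_mul_coordSum hS hI' fun k : Fin t => hasLaw_sub_const (hL k)]
  simp [dotProduct]
  field_simp

lemma integrable_empCov_sub_sq [IsProbabilityMeasure P] (hI : iIndepFun w P)
    (hL : ∀ k, HasLaw (w k) (multivariateGaussian μ S) P) (ht : 2 ≤ t) (i j : Fin n) :
    Integrable (fun ω => (empCov (fun k => w k ω) t i j - S i j) ^ 2) P := by
  have hI' : iIndepFun (fun (k : Fin t) ω => w k ω - μ) P :=
    (hI.precomp Fin.val_injective).comp (fun _ x => x - μ) (by fun_prop)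
  have hL' := fun k : Fin t => hasLaw_sub_const (hL k)
  simp_rw [empCov_apply _ (show 0 < t by omega) μ, sub_sq, mul_pow]
  exact (((integrable_gram_sq hI' hL' (centering t) i j).const_mul _).sub
    ((((integrable_gram hI' hL' (centering t) i j).const_mul _).const_mul _).mul_const _)).add
      (integrable_const _)

/-- The mean squared error of an entry of the empirical covariance of Gaussian vectors. -/
lemma integral_empCov_sub_sq [IsProbabilityMeasure P] (hS : S.PosSemidef) (hI : iIndepFun w P)
    (hL : ∀ k, HasLaw (w k) (multivariateGaussian μ S) P) (ht : 2 ≤ t) (i j : Fin n) :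
    ∫ ω, (empCov (fun k => w k ω) t i j - S i j) ^ 2 ∂P =
      (S i i * S j j + S i j ^ 2) / ((t : ℝ) - 1) := by
  have hI' : iIndepFun (fun (k : Fin t) ω => w k ω - μ) P :=
    (hI.precomp Fin.val_injective).comp (fun _ x => x - μ) (by fun_prop)
  have hL' := fun k : Fin t => hasLaw_sub_const (hL k)
  have ht0 : 0 < t := by omega
  have ht1 : (t : ℝ) - 1 ≠ 0 := by
    have : (2 : ℝ) ≤ t := by exact_mod_cast ht
    linarith
  simp_rw [empCov_apply _ ht0 μ, sub_sq, mul_pow]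
  have h2 := (integrable_gram_sq hI' hL' (centering t) i j).const_mul ((1 / ((t : ℝ) - 1)) ^ 2)
  have h1 := (((integrable_gram hI' hL' (centering t) i j).const_mul
    (1 / ((t : ℝ) - 1))).const_mul 2).mul_const (S i j)
  rw [integral_add (by exact h2.sub h1) (integrable_const _), integral_sub h2 h1, integral_const_mul,
    integral_mul_const, integral_const_mul, integral_const_mul, integral_gram_sq hS hI' hL',
    integral_gram hS hI' hL']
  -- Both coefficient sums equal `t - 1`: the estimator is unbiased, and only the cross pairings
  -- survive in the error.
  simp_rw [centering_dotProduct ht0, sum_centering_diag ht0, sum_centering_sq ht0]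
  simp
  field_simp
  ring

end Estimators

end Moments

open scoped MatrixOrder

/-! ### Markov bounds and the union bound -/

section Concentration

variable {n : ℕ} {Ω : Type*} [MeasurableSpace Ω] {P : Measure Ω} {S : Matrix (Fin n) (Fin n) ℝ}
  {μ : Vec n}

/-- Markov's inequality for the strict superlevel sets of a nonnegative function. -/
lemma measureReal_lt_le_div {f : Ω → ℝ} [IsFiniteMeasure P] (hf : ∀ ω, 0 ≤ f ω)
    (hint : Integrable f P) {r b : ℝ} (hr : 0 < r) (hb : ∫ ω, f ω ∂P ≤ b) :
    P.real {ω | r < f ω} ≤ b / r := by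
  rw [le_div_iff₀ hr, mul_comm]
  refine le_trans ?_ ((mul_meas_ge_le_integral_of_nonneg (Filter.Eventually.of_forall hf)
    hint r).trans hb)
  exact mul_le_mul_of_nonneg_left (measureReal_mono fun ω (hω : r < f ω) => hω.le) hr.le

lemma stdGaussian_norm_sq_gt_le {r : ℝ} (hr : 0 < r) :
    (stdGaussian (Vec n)).real {ξ | r < ‖ξ‖ ^ 2} ≤ n / r := by
  have hlaw : HasLaw (id : Vec n → Vec n) (multivariateGaussian 0 1) (stdGaussian (Vec n)) := by
    rw [multivariateGaussian_zero_one]; exact HasLaw.id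
  have hint : Integrable (fun ξ : Vec n => ‖ξ‖ ^ 2) (stdGaussian (Vec n)) :=
    hlaw.hasGaussianLaw.memLp_two.integrable_norm_pow (by norm_num)
  have hint' : ∀ i : Fin n, Integrable (fun ξ : Vec n => ξ i ^ 2) (stdGaussian (Vec n)) :=
    fun i => by
      simp_rw [pow_two]
      exact integrable_dual_mul_dual hlaw.hasGaussianLaw (EuclideanSpace.proj i)
        (EuclideanSpace.proj i)
  refine measureReal_lt_le_div (fun ξ => sq_nonneg _) hint hr (le_of_eq ?_)
  simp_rw [EuclideanSpace.real_norm_sq_eq]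
  rw [integral_finsetSum _ fun i _ => hint' i]
  simp_rw [pow_two]
  have h := fun i => integral_coord_mul_coord PosSemidef.one hlaw i i
  simp only [id] at h
  simp [h]

/-- A Gaussian vector with covariance `S` lies in the image under `√S` of the ball of squared
radius `r`, up to probability `n / r`. -/
lemma measureReal_notMem_sqrt_ball_le {X : Ω → Vec n}
    (hX : HasLaw X (multivariateGaussian μ S) P) {r : ℝ} (hr : 0 < r) :
    P.real {ω | X ω ∉ (fun ξ : Vec n => μ + toEuclideanCLM (𝕜 := ℝ) (CFC.sqrt S) ξ) ''
      {ξ | ‖ξ‖ ^ 2 ≤ r}} ≤ n / r := by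
  set F : Vec n → Vec n := fun ξ => μ + toEuclideanCLM (𝕜 := ℝ) (CFC.sqrt S) ξ with hF
  have hFc : Continuous F := by fun_prop
  have hball : {ξ : Vec n | ‖ξ‖ ^ 2 ≤ r} = Metric.closedBall 0 (Real.sqrt r) := by
    ext ξ
    simp [Real.le_sqrt (norm_nonneg ξ) hr.le]
  -- Compactness of the ball gives measurability of its image even when `√S` is singular.
  have hK : MeasurableSet (F '' {ξ : Vec n | ‖ξ‖ ^ 2 ≤ r}) := by
    rw [hball]
    exact ((isCompact_closedBall _ _).image hFc).isClosed.measurableSet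
  have h1 := hX.measureReal_eq (p := fun x => x ∉ F '' {ξ : Vec n | ‖ξ‖ ^ 2 ≤ r}) hK.compl
  have h2 : (multivariateGaussian μ S).real (F '' {ξ : Vec n | ‖ξ‖ ^ 2 ≤ r})ᶜ =
      (stdGaussian (Vec n)).real (F ⁻¹' (F '' {ξ : Vec n | ‖ξ‖ ^ 2 ≤ r})ᶜ) := by
    rw [multivariateGaussian, map_measureReal_apply hFc.measurable hK.compl]
  refine (le_of_eq (h1.trans h2)).trans ((measureReal_mono ?_).trans (stdGaussian_norm_sq_gt_le hr))
  intro ξ hξ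
  by_contra hlt
  exact hξ ⟨ξ, by simpa using hlt, rfl⟩

section Estimators

variable [IsProbabilityMeasure P] {w : ℕ → Ω → Vec n} {t : ℕ} {σ δ : ℝ}

lemma measureReal_empMean_gt_le (hS : S.PosSemidef)
    (hSσ : (σ • (1 : Matrix (Fin n) (Fin n) ℝ) - S).PosSemidef) (hI : iIndepFun w P)
    (hL : ∀ k, HasLaw (w k) (multivariateGaussian μ S) P) (ht : 0 < t) {r : ℝ} (hr : 0 < r) :
    P.real {ω | r < ∑ i, (empMean (fun k => w k ω) t - μ) i ^ 2} ≤ n * σ / t / r := by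
  have hint := integrable_empMean_sub_sq hI hL ht
  refine measureReal_lt_le_div (fun ω => Finset.sum_nonneg fun i _ => sq_nonneg _)
    (integrable_finsetSum _ fun i _ => hint i) hr ?_
  rw [integral_finsetSum _ fun i _ => hint i]
  simp_rw [integral_empMean_sub_sq hS hI hL ht]
  calc ∑ i, S i i / t ≤ ∑ _i : Fin n, σ / t := by
        gcongr with i; exact diag_le_of_posSemidef_sub hSσ i
    _ = n * σ / t := by simp [mul_div_assoc]

/-- Summing the entrywise errors gives `(tr S)² + ‖S‖²` (Frobenius) over `t - 1`, at most `(n² +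
n)σ² / (t - 1)`; this is the source of `n(n + 1)` in the inflation. -/
lemma measureReal_empCov_gt_le (hS : S.PosSemidef) (hσ : 0 ≤ σ)
    (hSσ : (σ • (1 : Matrix (Fin n) (Fin n) ℝ) - S).PosSemidef) (hI : iIndepFun w P)
    (hL : ∀ k, HasLaw (w k) (multivariateGaussian μ S) P) (ht : 2 ≤ t) {r : ℝ} (hr : 0 < r) :
    P.real {ω | r < ∑ i, ∑ j, (empCov (fun k => w k ω) t i j - S i j) ^ 2} ≤
      σ ^ 2 * (n * (n + 1)) / ((t : ℝ) - 1) / r := by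
  have hint := integrable_empCov_sub_sq hI hL ht
  have ht1 : (0 : ℝ) < (t : ℝ) - 1 := by
    have : (2 : ℝ) ≤ t := by exact_mod_cast ht
    linarith
  refine measureReal_lt_le_div
    (fun ω => Finset.sum_nonneg fun i _ => Finset.sum_nonneg fun j _ => sq_nonneg _)
    (integrable_finsetSum _ fun i _ => integrable_finsetSum _ fun j _ => hint i j) hr ?_
  rw [integral_finsetSum _ fun i _ => integrable_finsetSum _ fun j _ => hint i j]
  simp_rw [integral_finsetSum _ fun j _ => hint _ j, integral_empCov_sub_sq hS hI hL ht,
    ← Finset.sum_div, Finset.sum_add_distrib]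
  gcongr
  linarith [sum_sq_le_of_posSemidef_sub hσ hS hSσ, sum_diag_mul_diag_le hS hSσ]

lemma mem_uncertaintySet {v : ℕ → Vec n} {x : Vec n} (hn : 0 < n) (ht : 2 ≤ t)
    (hσ : 0 < σ) (hδ : 0 < δ) (hS : S.PosSemidef)
    (hmean : ∑ i, (empMean v t - μ) i ^ 2 ≤ 3 * (n : ℝ) * σ / ((t : ℝ) * δ))
    (hcov : ∑ i, ∑ j, (empCov v t i j - S i j) ^ 2 ≤
      (σ * Real.sqrt (3 * (n : ℝ) * ((n : ℝ) + 1) / (δ * ((t : ℝ) - 1)))) ^ 2)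
    (hx : x ∈ (fun ξ : Vec n => μ + toEuclideanCLM (𝕜 := ℝ) (CFC.sqrt S) ξ) ''
      {ξ | ‖ξ‖ ^ 2 ≤ 3 * (n : ℝ) / δ}) :
    x ∈ uncertaintySet σ δ v t := by
  obtain ⟨ξ, hξ, rfl⟩ := hx
  -- This shift recentres the ellipsoid at the true mean, leaving exactly `√S ξ`.
  refine ⟨μ - empMean v t, ?_, ?_⟩
  · refine le_trans (le_of_eq ?_) hmean
    simp only [dotProduct, PiLp.sub_apply]
    exact Finset.sum_congr rfl fun i _ => by ring
  · have he : (μ + toEuclideanCLM (𝕜 := ℝ) (CFC.sqrt S) ξ - empMean v t -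
        (μ - empMean v t)).ofLp = CFC.sqrt S *ᵥ ξ.ofLp := by
      rw [← ofLp_toEuclideanCLM]
      congr 1
      abel
    rw [he]
    refine dotProduct_inv_mulVec_le (transpose_sqrt S) (inflatedCov_posDef v ht hn hσ hδ) ?_ ?_
    · rw [sqrt_mul_sqrt hS]
      exact quadForm_le_add_of_sum_sq_le (by positivity) hcov
    · refine le_trans (le_of_eq ?_) hξ
      rw [EuclideanSpace.real_norm_sq_eq]
      simp [dotProduct, pow_two]

/-- The next disturbance lies in the uncertainty set with probability at least `1 - δ`. -/
lemma measureReal_notMem_uncertaintySet_le (hS : S.PosSemidef) (hσ : 0 < σ)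
    (hSσ : (σ • (1 : Matrix (Fin n) (Fin n) ℝ) - S).PosSemidef) (hδ : 0 < δ) (ht : 2 ≤ t)
    (hI : iIndepFun w P) (hL : ∀ k, HasLaw (w k) (multivariateGaussian μ S) P) :
    P.real {ω | w t ω ∉ uncertaintySet σ δ (fun k => w k ω) t} ≤ δ := by
  -- For `n = 0` the Markov thresholds vanish, but the uncertainty set is the whole one-point space.
  rcases Nat.eq_zero_or_pos n with hn | hn
  · subst hn
    have : {ω | w t ω ∉ uncertaintySet σ δ (fun k => w k ω) t} = ∅ := by
      ext ω
      simp [uncertaintySet, dotProduct]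
    rw [this, measureReal_empty]
    exact hδ.le
  have hn' : (0 : ℝ) < n := by exact_mod_cast hn
  have ht2 : (2 : ℝ) ≤ t := by exact_mod_cast ht
  have ht0 : (0 : ℝ) < t := by linarith
  have ht1 : (0 : ℝ) < (t : ℝ) - 1 := by linarith
  have hc : 0 < 3 * (n : ℝ) * ((n : ℝ) + 1) / (δ * ((t : ℝ) - 1)) := by positivity
  have h1 := measureReal_empMean_gt_le hS hSσ hI hL (show 0 < t by omega)
    (r := 3 * (n : ℝ) * σ / ((t : ℝ) * δ)) (by positivity)
  have h2 := measureReal_empCov_gt_le hS hσ.le hSσ hI hL ht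
    (r := (σ * Real.sqrt (3 * (n : ℝ) * ((n : ℝ) + 1) / (δ * ((t : ℝ) - 1)))) ^ 2)
    (by have := Real.sqrt_pos.2 hc; positivity)
  have h3 := measureReal_notMem_sqrt_ball_le (hL t) (r := 3 * (n : ℝ) / δ) (by positivity)
  -- The radii in the uncertainty set make each Markov bound equal to `δ / 3`.
  have e1 : n * σ / t / (3 * (n : ℝ) * σ / ((t : ℝ) * δ)) = δ / 3 := by field_simp
  have e2 : σ ^ 2 * (n * (n + 1)) / ((t : ℝ) - 1) /
      (σ * Real.sqrt (3 * (n : ℝ) * ((n : ℝ) + 1) / (δ * ((t : ℝ) - 1)))) ^ 2 = δ / 3 := by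
    rw [mul_pow, Real.sq_sqrt hc.le]
    field_simp
  have e3 : (n : ℝ) / (3 * (n : ℝ) / δ) = δ / 3 := by field_simp
  rw [e1] at h1
  rw [e2] at h2
  rw [e3] at h3
  refine (measureReal_mono (s₂ := _ ∪ (_ ∪ _)) ?_).trans ((measureReal_union_le _ _).trans
    ((add_le_add h1 ((measureReal_union_le _ _).trans (add_le_add h2 h3))).trans (by linarith)))
  intro ω hω
  by_contra hcon
  simp only [Set.mem_union, Set.mem_ofPred_eq, not_or, not_lt, not_not] at hcon
  exact hω (mem_uncertaintySet hn ht hσ hδ hS hcon.1 hcon.2.1 hcon.2.2)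

end Estimators

end Concentration

end SafeLearning

/-- The first conclusion bounds the probability that the program is feasible and the next state is
nevertheless unsafe; the second is the safety guarantee for an (almost surely) feasible program. -/
theorem theorem8 {n m : ℕ} {p : ℕ → ℕ}
    {Ω : Type*} [MeasurableSpace Ω] (P : Measure Ω) [IsProbabilityMeasure P]
    (f : SafeLearning.Vec n → SafeLearning.Vec n)
    (g : SafeLearning.Vec n → Matrix (Fin n) (Fin m) ℝ)
    (H : (k : ℕ) → Matrix (Fin (p k)) (Fin n) ℝ) (h : (k : ℕ) → Fin (p k) → ℝ)
    (d : SafeLearning.Vec m → SafeLearning.Vec m → ℝ)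
    (μw : SafeLearning.Vec n) (Sw : Matrix (Fin n) (Fin n) ℝ) (hSw : Sw.PosSemidef)
    (σ : ℝ) (hσ : 0 < σ)
    (hSσ : (σ • (1 : Matrix (Fin n) (Fin n) ℝ) - Sw).PosSemidef)
    (δ : ℝ) (hδ : 0 < δ) (t : ℕ) (ht : 2 ≤ t)
    (x : ℕ → Ω → SafeLearning.Vec n) (u ubar : ℕ → Ω → SafeLearning.Vec m)
    (w : ℕ → Ω → SafeLearning.Vec n)
    (hw_indep : iIndepFun w P)
    (hw_law : ∀ k, HasLaw (w k) (multivariateGaussian μw Sw) P)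
    (hx : ∀ k, ∀ᵐ ω ∂P, x (k + 1) ω = SafeLearning.step f g (x k ω) (u k ω) (w k ω))
    (hu : ∀ᵐ ω ∂P,
      (SafeLearning.feasibleControls f g (H (t + 1)) (h (t + 1))
        (SafeLearning.uncertaintySet σ δ (fun k => w k ω) t) (x t ω)).Nonempty →
      u t ω ∈ SafeLearning.argminControls d (ubar t ω)
        (SafeLearning.feasibleControls f g (H (t + 1)) (h (t + 1))
          (SafeLearning.uncertaintySet σ δ (fun k => w k ω) t) (x t ω))) :
    P.real {ω |
        (SafeLearning.feasibleControls f g (H (t + 1)) (h (t + 1))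
          (SafeLearning.uncertaintySet σ δ (fun k => w k ω) t) (x t ω)).Nonempty ∧
        ¬ SafeLearning.IsSafe (H (t + 1)) (h (t + 1)) (x (t + 1) ω)} ≤ δ ∧
    ((∀ᵐ ω ∂P,
        (SafeLearning.feasibleControls f g (H (t + 1)) (h (t + 1))
          (SafeLearning.uncertaintySet σ δ (fun k => w k ω) t) (x t ω)).Nonempty) →
      1 - δ ≤ P.real {ω | SafeLearning.IsSafe (H (t + 1)) (h (t + 1)) (x (t + 1) ω)}) := by
  set violation : Set Ω := {ω |
    (SafeLearning.feasibleControls f g (H (t + 1)) (h (t + 1))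
      (SafeLearning.uncertaintySet σ δ (fun k => w k ω) t) (x t ω)).Nonempty ∧
    ¬ SafeLearning.IsSafe (H (t + 1)) (h (t + 1)) (x (t + 1) ω)}
  have hmain : P.real violation ≤ δ := by
    refine le_trans ?_ (SafeLearning.measureReal_notMem_uncertaintySet_le hSw hσ hSσ hδ ht
      hw_indep hw_law)
    -- Almost-everywhere inclusion suffices for outer measure, so the violation set need not be
    -- measurable.
    refine ENNReal.toReal_mono (measure_ne_top _ _) (measure_mono_ae ?_)
    filter_upwards [hx t, hu] with ω hxω huω hω hmem
    refine hω.2 ?_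
    rw [hxω]
    exact (huω hω.1).1 _ hmem
  refine ⟨hmain, fun hfeas => ?_⟩
  have hcompl : P.real {ω | SafeLearning.IsSafe (H (t + 1)) (h (t + 1)) (x (t + 1) ω)}ᶜ ≤ δ := by
    refine le_trans (ENNReal.toReal_mono (measure_ne_top _ _) (measure_mono_ae ?_)) hmain
    filter_upwards [hfeas] with ω hω hviol
    exact ⟨hω, hviol⟩
  -- Subadditivity replaces the complement formula, since the safe event need not be measurable.
  have hcover := measureReal_union_le (μ := P)
    {ω | SafeLearning.IsSafe (H (t + 1)) (h (t + 1)) (x (t + 1) ω)}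
    {ω | SafeLearning.IsSafe (H (t + 1)) (h (t + 1)) (x (t + 1) ω)}ᶜ
  rw [Set.union_compl_self, probReal_univ] at hcover
  linarith
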